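/- Let $n\ge 1$ be an integer and $1<p<\infty$. For a locally integrable function $f$ on $\mathbb R^n$ define the strong maximal function $$(\mathcal N_n f)(x)=\sup_{a_i<x_i<b_i,\ i=1,\dots,n}\ \frac{1}{(b_1-a_1)\cdots(b_n-a_n)}\int_{a_1}^{b_1}\!\!\cdots\int_{a_n}^{b_n}|f(y_1,\dots,y_n)|\,dy_n\cdots dy_1 .$$ Then the equation $$(p-1)\,x^{p}-p\,x^{p-1}-1=0$$ has a unique positive solution $c_p$, the operator $\mathcal N_n$ maps $L^p(\mathbb R^n)$ into $L^p(\mathbb R^n)$, and its operator norm, that is, the least $C\ge 0$ such that $\|\mathcal N_n f\|_{L^p(\mathbb R^n)}\le C\,\|f\|_{L^p(\mathbb R^n)}$ for all $f\in L^p(\mathbb R^n)$, is equal to $c_p^{\,n}$. -/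

import Mathlib

open MeasureTheory
open scoped ENNReal

noncomputable section

/-- The strong maximal function `𝒩ₙ f` on `ℝⁿ`: the supremum of the averages of `|f|` over all
boxes `[a₁, b₁] × ⋯ × [aₙ, bₙ]` with `aᵢ < xᵢ < bᵢ` for every `i`. It takes values in `[0, ∞]`. -/
def strongMaximal {n : ℕ} {𝕜 : Type*} [RCLike 𝕜] (f : (Fin n → ℝ) → 𝕜) (x : Fin n → ℝ) : ℝ≥0∞ :=
  ⨆ (a : Fin n → ℝ) (b : Fin n → ℝ) (_ : ∀ i, a i < x i ∧ x i < b i),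
    (∏ i, ENNReal.ofReal (b i - a i))⁻¹ * ∫⁻ y in Set.Icc a b, ‖f y‖ₑ

/-- The operator norm on `L^p(μ)` of a (not necessarily linear) operator `T` whose values are
`[0, ∞]`-valued functions: the infimum of all `C ∈ [0, ∞]` with `‖T f‖_p ≤ C ‖f‖_p` for every
`f ∈ L^p(μ)`. -/
def lpOperatorNorm {α 𝕜 : Type*} [MeasurableSpace α] [RCLike 𝕜]
    (T : (α → 𝕜) → α → ℝ≥0∞) (p : ℝ≥0∞) (μ : Measure α) : ℝ≥0∞ :=
  sInf {C : ℝ≥0∞ | ∀ f : α → 𝕜, MemLp f p μ → eLpNorm (T f) p μ ≤ C * eLpNorm f p μ}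

end

/-!
In dimension one, a finite family of intervals can be thinned out, without changing its union, until
no point lies in more than two of them. This refines the weak-type inequality for the maximal
function `M g` to `t |{M g > t}| + t |{g > t}| ≤ ∫_{M g > t} g + ∫_{g > t} g`. Integrating against
`t ^ (p - 2)` and estimating `∫ g (M g) ^ (p - 1)` by Young's inequality with weight `c` gives
`‖M g‖ₚ ≤ c ‖g‖ₚ`, precisely because `c` solves the equation. In dimension `n` the strong maximal
function is dominated by the one-dimensional operators applied successively in each variable, which
yields the bound `c ^ n`.

For sharpness, take products of truncated powers `|x| ^ (-α)` with `α` increasing to `1 / p`: up to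
reflection, averaging over `[-s x, x]` with `s = c ^ (-p)` multiplies each factor by a constant that
tends to `c`.
-/

/-- `IsMaximalConst p c` says that `c` is a positive root of `(p - 1) x ^ p - p x ^ (p - 1) - 1`,
the sharp constant of the one-dimensional maximal inequality. -/
def IsMaximalConst (p c : ℝ) : Prop :=
  0 < c ∧ (p - 1) * c ^ p - p * c ^ (p - 1) - 1 = 0

theorem isMaximalConst_iff {p c : ℝ} (hc : 0 < c) :
    IsMaximalConst p c ↔ c ^ (p - 1) * ((p - 1) * c - p) = 1 := by
  have hcp : c ^ p = c ^ (p - 1) * c := by rw [← Real.rpow_add_one hc.ne', sub_add_cancel]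
  rw [IsMaximalConst, and_iff_right hc, sub_eq_zero, hcp,
    show (p - 1) * (c ^ (p - 1) * c) - p * c ^ (p - 1) = c ^ (p - 1) * ((p - 1) * c - p) by ring]

theorem strictMonoOn_rpow_mul_sub {p : ℝ} (hp : 1 < p) :
    StrictMonoOn (fun c : ℝ => c ^ (p - 1) * ((p - 1) * c - p)) (Set.Ici (p / (p - 1))) := by
  intro x hx y _ hxy
  have hp1 : 0 < p - 1 := by linarith
  have hx0 : 0 < x := (by positivity : 0 < p / (p - 1)).trans_le hx
  have hxp : 0 ≤ (p - 1) * x - p := by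
    rw [Set.mem_Ici, div_le_iff₀ hp1] at hx
    linarith
  have hpow : x ^ (p - 1) < y ^ (p - 1) := Real.rpow_lt_rpow hx0.le hxy hp1
  have hlin : (p - 1) * x - p < (p - 1) * y - p := by gcongr
  exact mul_lt_mul'' hpow hlin (by positivity) hxp

namespace IsMaximalConst

variable {p c : ℝ}

theorem pos (h : IsMaximalConst p c) : 0 < c := h.1

theorem div_sub_one_lt (h : IsMaximalConst p c) (hp : 1 < p) : p / (p - 1) < c := by
  have hpos : 0 < (p - 1) * c - p :=
    pos_of_mul_pos_right (((isMaximalConst_iff h.pos).1 h).symm ▸ one_pos)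
      (Real.rpow_nonneg h.pos.le _)
  rw [div_lt_iff₀ (by linarith)]
  linarith

theorem one_lt (h : IsMaximalConst p c) (hp : 1 < p) : 1 < c :=
  ((one_lt_div (by linarith)).2 (by linarith)).trans (h.div_sub_one_lt hp)

end IsMaximalConst

theorem existsUnique_isMaximalConst {p : ℝ} (hp : 1 < p) : ∃! c : ℝ, IsMaximalConst p c := by
  have hp1 : 0 < p - 1 := by linarith
  set φ : ℝ → ℝ := fun c => c ^ (p - 1) * ((p - 1) * c - p) with hφ
  have hcont : Continuous φ := (Real.continuous_rpow_const hp1.le).mul (by fun_prop)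
  have hle : p / (p - 1) ≤ (p + 1) / (p - 1) := by gcongr; linarith
  have hone : 1 ∈ Set.Icc (φ (p / (p - 1))) (φ ((p + 1) / (p - 1))) := by
    have hbase : 1 ≤ (p + 1) / (p - 1) := by rw [one_le_div hp1]; linarith
    simpa [hφ, mul_div_cancel₀ _ hp1.ne'] using Real.one_le_rpow hbase hp1.le
  obtain ⟨c, hc, hroot⟩ := intermediate_value_Icc hle hcont.continuousOn hone
  have hc0 : 0 < c := (by positivity : 0 < p / (p - 1)).trans_le hc.1
  have hcmax : IsMaximalConst p c := (isMaximalConst_iff hc0).2 hroot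
  refine ⟨c, hcmax, fun d hd => (strictMonoOn_rpow_mul_sub hp).injOn
    (hd.div_sub_one_lt hp).le (hcmax.div_sub_one_lt hp).le ?_⟩
  exact ((isMaximalConst_iff hd.pos).1 hd).trans hroot.symm

theorem exists_subfamily_biUnion_Ioo_eq {ι α : Type*} [LinearOrder α] (s : Finset ι)
    (a b : ι → α) :
    ∃ t ⊆ s, (⋃ i ∈ t, Set.Ioo (a i) (b i)) = (⋃ i ∈ s, Set.Ioo (a i) (b i)) ∧
      ∀ x, (t.filter fun i => x ∈ Set.Ioo (a i) (b i)).card ≤ 2 := by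
  classical
  -- In a minimal subfamily, three intervals cannot share a point: the one reaching furthest left
  -- and the one reaching furthest right would make the third one superfluous.
  obtain ⟨t, ht, hmin⟩ := (s.powerset.filter fun t =>
      (⋃ i ∈ t, Set.Ioo (a i) (b i)) = (⋃ i ∈ s, Set.Ioo (a i) (b i))).exists_min_image
    Finset.card ⟨s, by simp⟩
  simp only [Finset.mem_filter, Finset.mem_powerset] at ht hmin
  refine ⟨t, ht.1, ht.2, fun x => ?_⟩
  by_contra! hcard
  set u := t.filter fun i => x ∈ Set.Ioo (a i) (b i)
  have hmem {i : ι} (hi : i ∈ u) : i ∈ t ∧ a i < x ∧ x < b i := by simpa [u] using hi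
  have hne : u.Nonempty := Finset.card_pos.mp (by omega)
  obtain ⟨l, hl, hl'⟩ := u.exists_min_image a hne
  obtain ⟨r, hr, hr'⟩ := u.exists_max_image b hne
  obtain ⟨k, hk, hkl, hkr⟩ : ∃ k ∈ u, k ≠ l ∧ k ≠ r := by
    by_contra! hcon
    have hsub : u ⊆ {l, r} := fun k hk => by
      by_cases hkl : k = l
      · simp [hkl]
      · simp [hcon k hk hkl]
    have := (Finset.card_le_card hsub).trans Finset.card_le_two
    omega
  have hlt : (t.erase k).card < t.card := Finset.card_erase_lt_of_mem (hmem hk).1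
  refine (hmin (t.erase k) ⟨(Finset.erase_subset _ _).trans ht.1, ?_⟩).not_gt hlt
  rw [← ht.2]
  refine (Set.biUnion_subset_biUnion_left (Finset.erase_subset k t)).antisymm
    (Set.iUnion₂_subset fun i hi y hy => ?_)
  simp only [Set.mem_iUnion, exists_prop]
  by_cases hik : i = k
  · subst hik
    rcases lt_or_ge y x with hyx | hxy
    · exact ⟨l, Finset.mem_erase.2 ⟨hkl.symm, (hmem hl).1⟩,
        (hl' i hk).trans_lt hy.1, hyx.trans (hmem hl).2.2⟩
    · exact ⟨r, Finset.mem_erase.2 ⟨hkr.symm, (hmem hr).1⟩,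
        (hmem hr).2.1.trans_le hxy, hy.2.trans_le (hr' i hk)⟩
  · exact ⟨i, Finset.mem_erase.2 ⟨hik, hi⟩, hy⟩

theorem lintegral_card_filter_mem_mul {α ι : Type*} [MeasurableSpace α] {μ : Measure α}
    (s : Finset ι) {E : ι → Set α} [∀ i, DecidablePred (· ∈ E i)]
    (hE : ∀ i ∈ s, MeasurableSet (E i)) {g : α → ℝ≥0∞} (hg : Measurable g) :
    ∫⁻ x, (s.filter fun i => x ∈ E i).card * g x ∂μ = ∑ i ∈ s, ∫⁻ x in E i, g x ∂μ := by
  have hcard (x : α) : (s.filter fun i => x ∈ E i).card * g x = ∑ i ∈ s, (E i).indicator g x := by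
    simp only [Finset.card_filter, Nat.cast_sum, Finset.sum_mul, Set.indicator_apply]
    exact Finset.sum_congr rfl fun i _ => by split_ifs <;> simp
  simp_rw [hcard]
  rw [lintegral_finsetSum' _ fun i hi => (hg.indicator (hE i hi)).aemeasurable]
  exact Finset.sum_congr rfl fun i hi => lintegral_indicator (hE i hi) _

theorem ite_add_ite_add_natCast_mul_le {k : ℕ} (hk : k ≤ 2) (t v : ℝ≥0∞) :
    (if k ≠ 0 then t else 0) + (if t < v then t else 0) + k * v ≤
      (if k ≠ 0 then v else 0) + (if t < v then v else 0) + k * t := by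
  rcases lt_or_ge t v with h | h
  · interval_cases k
    · simpa [h] using h.le
    · simp only [h, if_true, ne_eq, one_ne_zero, not_false_eq_true, Nat.cast_one, one_mul]
      calc t + t + v ≤ t + v + v := by gcongr
        _ = v + v + t := by ring
    · simp only [h, if_true, ne_eq, OfNat.ofNat_ne_zero, not_false_eq_true, Nat.cast_ofNat]
      exact (by ring : _ = _).le
  · interval_cases k
    · simp [h.not_gt]
    · simp [h.not_gt, add_comm]
    · simp only [h.not_gt, if_true, if_false, ne_eq, OfNat.ofNat_ne_zero, not_false_eq_true,
        Nat.cast_ofNat, add_zero, two_mul]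
      rw [← add_assoc, ← add_assoc, add_comm v t]
      gcongr

theorem mul_measure_biUnion_add_le {α ι : Type*} [MeasurableSpace α] {μ : Measure α}
    (s : Finset ι) {E : ι → Set α} [∀ i, DecidablePred (· ∈ E i)]
    (hE : ∀ i ∈ s, MeasurableSet (E i)) (hover : ∀ x, (s.filter fun i => x ∈ E i).card ≤ 2)
    {g : α → ℝ≥0∞} (hg : Measurable g) (hfin : ∫⁻ x, g x ∂μ ≠ ∞) {t : ℝ≥0∞}
    (h : ∀ i ∈ s, t * μ (E i) ≤ ∫⁻ x in E i, g x ∂μ) :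
    t * μ (⋃ i ∈ s, E i) + t * μ {x | t < g x} ≤
      ∫⁻ x in ⋃ i ∈ s, E i, g x ∂μ + ∫⁻ x in {x | t < g x}, g x ∂μ := by
  set A := ⋃ i ∈ s, E i with hA
  set P := {x | t < g x} with hP
  set w : α → ℝ≥0∞ := fun x => (s.filter fun i => x ∈ E i).card with hw
  have hAm : MeasurableSet A := s.measurableSet_biUnion hE
  have hPm : MeasurableSet P := measurableSet_lt measurable_const hg
  have hwm : Measurable w := by
    simp only [hw, Finset.card_filter, Nat.cast_sum, Nat.cast_ite, Nat.cast_one, Nat.cast_zero]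
    exact Finset.measurable_fun_sum _ fun i hi =>
      Measurable.ite (hE i hi) measurable_const measurable_const
  have hwt_le : ∫⁻ x, w x * t ∂μ ≤ ∫⁻ x, w x * g x ∂μ := by
    rw [lintegral_card_filter_mem_mul s hE measurable_const, lintegral_card_filter_mem_mul s hE hg]
    simpa only [setLIntegral_const] using Finset.sum_le_sum h
  have hwg_fin : ∫⁻ x, w x * g x ∂μ ≠ ∞ := by
    refine ne_top_of_le_ne_top (ENNReal.mul_ne_top (a := 2) (by simp) hfin) ?_
    rw [← lintegral_const_mul _ hg]
    gcongr with x
    simp only [hw]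
    exact_mod_cast hover x
  have hpoint (x : α) : A.indicator (fun _ => t) x + P.indicator (fun _ => t) x + w x * g x ≤
      A.indicator g x + P.indicator g x + w x * t := by
    have hxA : x ∈ A ↔ (s.filter fun i => x ∈ E i).card ≠ 0 := by
      simp [hA, Finset.filter_eq_empty_iff]
    classical
    simpa only [Set.indicator_apply, hxA, hP, Set.mem_ofPred_eq] using
      ite_add_ite_add_natCast_mul_le (hover x) t (g x)
  have hwgm : Measurable fun x => w x * g x := hwm.mul hg
  have hint := lintegral_mono (μ := μ) hpoint
  rw [lintegral_add_right _ hwgm, lintegral_add_right _ (measurable_const.indicator hPm),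
    lintegral_add_right _ (hwm.mul_const t), lintegral_add_right _ (hg.indicator hPm),
    lintegral_indicator_const hAm, lintegral_indicator_const hPm, lintegral_indicator hAm,
    lintegral_indicator hPm] at hint
  exact (ENNReal.add_le_add_iff_right hwg_fin).1 (hint.trans (by gcongr))

section WeakType

variable {α : Type*} [MeasurableSpace α] {μ : Measure α}

theorem lintegral_rpow_eq_lintegral_measure_ofReal_lt_mul {h : α → ℝ≥0∞} (hh : Measurable h)
    (hfin : ∀ x, h x ≠ ∞) {r : ℝ} (hr : 0 < r) :
    ∫⁻ x, h x ^ r ∂μ = ENNReal.ofReal r *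
      ∫⁻ t in Set.Ioi (0 : ℝ), μ {x | ENNReal.ofReal t < h x} * ENNReal.ofReal (t ^ (r - 1)) := by
  convert lintegral_rpow_eq_lintegral_meas_lt_mul μ (f := fun x => (h x).toReal)
    (.of_forall fun x => ENNReal.toReal_nonneg) hh.ennreal_toReal.aemeasurable hr using 1
  · refine lintegral_congr fun x => ?_
    rw [← ENNReal.ofReal_rpow_of_nonneg ENNReal.toReal_nonneg hr.le,
      ENNReal.ofReal_toReal (hfin x)]
  · congr 1
    refine setLIntegral_congr_fun measurableSet_Ioi fun t ht => ?_
    simp only [ENNReal.ofReal_lt_iff_lt_toReal (le_of_lt ht) (hfin _)]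

theorem measurable_measure_ofReal_lt_mul (h : α → ℝ≥0∞) (r : ℝ) :
    Measurable fun t : ℝ => μ {x | ENNReal.ofReal t < h x} * ENNReal.ofReal (t ^ r) := by
  have hanti : Antitone fun t : ℝ => μ {x | ENNReal.ofReal t < h x} := fun s t hst =>
    measure_mono fun x hx => (ENNReal.ofReal_le_ofReal hst).trans_lt hx
  exact hanti.measurable.mul (by fun_prop)

theorem lintegral_rpow_add_lintegral_rpow_eq {h k : α → ℝ≥0∞} (hh : Measurable h)
    (hk : Measurable k) (hhfin : ∀ x, h x ≠ ∞) (hkfin : ∀ x, k x ≠ ∞) {r : ℝ} (hr : 0 < r) :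
    ∫⁻ x, h x ^ r ∂μ + ∫⁻ x, k x ^ r ∂μ = ENNReal.ofReal r * ∫⁻ t in Set.Ioi (0 : ℝ),
      (μ {x | ENNReal.ofReal t < h x} + μ {x | ENNReal.ofReal t < k x}) *
        ENNReal.ofReal (t ^ (r - 1)) := by
  simp_rw [add_mul]
  rw [lintegral_add_left (measurable_measure_ofReal_lt_mul _ _), mul_add,
    lintegral_rpow_eq_lintegral_measure_ofReal_lt_mul hh hhfin hr,
    lintegral_rpow_eq_lintegral_measure_ofReal_lt_mul hk hkfin hr]

theorem lintegral_rpow_add_le_of_weakType {M g : α → ℝ≥0∞} (hM : Measurable M) (hg : Measurable g)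
    (hMfin : ∀ x, M x ≠ ∞) (hgfin : ∀ x, g x ≠ ∞) {p : ℝ} (hp : 1 < p)
    (hweak : ∀ t, t * μ {x | t < M x} + t * μ {x | t < g x} ≤
      ∫⁻ x in {x | t < M x}, g x ∂μ + ∫⁻ x in {x | t < g x}, g x ∂μ) :
    ENNReal.ofReal (p - 1) * (∫⁻ x, M x ^ p ∂μ + ∫⁻ x, g x ^ p ∂μ) ≤
      ENNReal.ofReal p * (∫⁻ x, g x * M x ^ (p - 1) ∂μ + ∫⁻ x, g x * g x ^ (p - 1) ∂μ) := by
  have hp1 : 0 < p - 1 := by linarith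
  have hdensity {h : α → ℝ≥0∞} (hh : Measurable h) :
      ∫⁻ x, g x * h x ^ (p - 1) ∂μ = ∫⁻ x, h x ^ (p - 1) ∂μ.withDensity g :=
    (lintegral_withDensity_eq_lintegral_mul _ hg (hh.pow_const _)).symm
  rw [hdensity hM, hdensity hg,
    lintegral_rpow_add_lintegral_rpow_eq hM hg hMfin hgfin (by linarith : 0 < p),
    lintegral_rpow_add_lintegral_rpow_eq hM hg hMfin hgfin hp1, mul_left_comm]
  gcongr _ * (_ * ?_)
  refine setLIntegral_mono' measurableSet_Ioi fun t (ht : 0 < t) => ?_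
  have hpow : ENNReal.ofReal (t ^ (p - 1)) =
      ENNReal.ofReal t * ENNReal.ofReal (t ^ (p - 1 - 1)) := by
    rw [← ENNReal.ofReal_mul ht.le, mul_comm t, ← Real.rpow_add_one ht.ne', sub_add_cancel]
  rw [hpow, ← mul_assoc, mul_comm _ (ENNReal.ofReal t), mul_add,
    withDensity_apply _ (measurableSet_lt measurable_const hM),
    withDensity_apply _ (measurableSet_lt measurable_const hg)]
  gcongr ?_ * _
  exact hweak _

theorem ofReal_mul_mul_rpow_sub_one_le {p : ℝ} (hp : 1 < p) (a b : ℝ≥0∞) :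
    ENNReal.ofReal p * (a * b ^ (p - 1)) ≤ a ^ p + ENNReal.ofReal (p - 1) * b ^ p := by
  have hp0 : 0 < p := by linarith
  have hp1 : 0 < p - 1 := by linarith
  have hofReal : ENNReal.ofReal p ≠ 0 := by simpa using hp0
  have hpow : (b ^ (p - 1)) ^ (p / (p - 1)) = b ^ p := by
    rw [← ENNReal.rpow_mul, mul_div_cancel₀ _ hp1.ne']
  calc ENNReal.ofReal p * (a * b ^ (p - 1))
      ≤ ENNReal.ofReal p *
          (a ^ p / ENNReal.ofReal p + b ^ p / ENNReal.ofReal (p / (p - 1))) := by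
        gcongr
        simpa only [Real.conjExponent, hpow] using
          ENNReal.young_inequality a (b ^ (p - 1)) (Real.HolderConjugate.conjExponent hp)
    _ = a ^ p + ENNReal.ofReal (p - 1) * b ^ p := by
        rw [mul_add, ENNReal.mul_div_cancel hofReal ENNReal.ofReal_ne_top, ← mul_div_assoc,
          ENNReal.mul_div_right_comm, ← ENNReal.ofReal_div_of_pos (by positivity),
          div_div_cancel₀ hp0.ne']

theorem IsMaximalConst.le_rpow_mul {p c X Y F : ℝ} (hc : IsMaximalConst p c) (hp : 1 < p)
    (hweak : (p - 1) * (X + F) ≤ p * (Y + F))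
    (hyoung : p * (c * Y) ≤ c ^ p * F + (p - 1) * X) : X ≤ c ^ p * F := by
  have hc1 := hc.one_lt hp
  have hroot : (p - 1) * (c - 1) * c ^ p = c ^ p + c := by
    have hcp : c ^ p = c ^ (p - 1) * c := by
      rw [← Real.rpow_add_one hc.pos.ne', sub_add_cancel]
    linear_combination c * hc.2 - p * hcp
  refine le_of_mul_le_mul_left ?_ (mul_pos (sub_pos.2 hp) (sub_pos.2 hc1))
  calc (p - 1) * (c - 1) * X = c * ((p - 1) * (X + F)) - (p - 1) * X - c * (p - 1) * F := by ring
    _ ≤ c * (p * (Y + F)) - (p - 1) * X - c * (p - 1) * F := by gcongr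
    _ ≤ (c ^ p + c) * F := by linarith
    _ = (p - 1) * (c - 1) * (c ^ p * F) := by rw [← hroot]; ring

theorem IsMaximalConst.le_ofReal_rpow_mul {p c : ℝ} {X Y F : ℝ≥0∞} (hc : IsMaximalConst p c)
    (hp : 1 < p) (hY : Y ≠ ∞) (hF : F ≠ ∞)
    (hweak : ENNReal.ofReal (p - 1) * (X + F) ≤ ENNReal.ofReal p * (Y + F))
    (hyoung : ENNReal.ofReal p * (ENNReal.ofReal c * Y) ≤
      ENNReal.ofReal (c ^ p) * F + ENNReal.ofReal (p - 1) * X) :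
    X ≤ ENNReal.ofReal (c ^ p) * F := by
  have hc0 := hc.pos
  have hp0 : 0 ≤ p := by linarith
  have hp1 : 0 < p - 1 := by linarith
  have hX : X ≠ ∞ := by
    rintro rfl
    have htop : ENNReal.ofReal (p - 1) * (∞ + F) = ∞ := by
      rw [top_add, ENNReal.mul_top (by simpa using hp)]
    rw [htop, top_le_iff] at hweak
    exact (by finiteness : ENNReal.ofReal p * (Y + F) ≠ ∞) hweak
  lift X to NNReal using hX
  lift F to NNReal using hF
  lift Y to NNReal using hY
  have hreal : (X : ℝ) ≤ c ^ p * F := by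
    refine hc.le_rpow_mul hp (Y := Y) ?_ ?_
    · simpa [ENNReal.toReal_add, hp1.le, hp0] using
        ENNReal.toReal_mono (by finiteness) hweak
    · simpa [ENNReal.toReal_add, ENNReal.mul_ne_top, hp1.le, hp0, hc0.le, Real.rpow_nonneg] using
        ENNReal.toReal_mono (by finiteness) hyoung
  simpa [ENNReal.ofReal_mul (Real.rpow_nonneg hc0.le p)] using ENNReal.ofReal_le_ofReal hreal

theorem lintegral_rpow_le_of_weakType {M g : α → ℝ≥0∞} (hM : Measurable M) (hg : Measurable g)
    {K : ℝ≥0∞} (hMK : ∀ x, M x ≤ K) (hgK : ∀ x, g x ≤ K) (hK : K ≠ ∞)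
    (hfin : ∫⁻ x, g x ∂μ ≠ ∞) {p c : ℝ} (hp : 1 < p) (hc : IsMaximalConst p c)
    (hweak : ∀ t, t * μ {x | t < M x} + t * μ {x | t < g x} ≤
      ∫⁻ x in {x | t < M x}, g x ∂μ + ∫⁻ x in {x | t < g x}, g x ∂μ) :
    ∫⁻ x, M x ^ p ∂μ ≤ ENNReal.ofReal (c ^ p) * ∫⁻ x, g x ^ p ∂μ := by
  have hp0 : 0 < p := by linarith
  have hp1 : 0 < p - 1 := by linarith
  have hmulfin {h : α → ℝ≥0∞} (hhK : ∀ x, h x ≤ K) : ∫⁻ x, g x * h x ^ (p - 1) ∂μ ≠ ∞ := by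
    refine ne_top_of_le_ne_top
      (ENNReal.mul_ne_top hfin (ENNReal.rpow_ne_top_of_nonneg hp1.le hK)) ?_
    rw [← lintegral_mul_const _ hg]
    gcongr
    exact hhK _
  have hgpow : ∫⁻ x, g x * g x ^ (p - 1) ∂μ = ∫⁻ x, g x ^ p ∂μ := by
    refine lintegral_congr fun x => ?_
    simpa using (ENNReal.rpow_add_of_nonneg (x := g x) 1 (p - 1) zero_le_one hp1.le).symm
  have hmain := lintegral_rpow_add_le_of_weakType hM hg
    (fun x => ne_top_of_le_ne_top hK (hMK x)) (fun x => ne_top_of_le_ne_top hK (hgK x)) hp hweak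
  rw [hgpow] at hmain
  refine hc.le_ofReal_rpow_mul hp (hmulfin hMK) (hgpow ▸ hmulfin hgK) hmain ?_
  rw [← lintegral_const_mul _ (by fun_prop), ← lintegral_const_mul _ (by fun_prop),
    ← lintegral_const_mul _ (by fun_prop), ← lintegral_const_mul _ (by fun_prop),
    ← lintegral_add_left (by fun_prop)]
  -- The weight `c` is the one for which Young's inequality is an equality when `M x = c * g x`.
  refine lintegral_mono fun x => ?_
  simpa only [ENNReal.mul_rpow_of_nonneg _ _ hp0.le, ENNReal.ofReal_rpow_of_pos hc.pos,
    mul_assoc] using ofReal_mul_mul_rpow_sub_one_le hp (ENNReal.ofReal c * g x) (M x)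

end WeakType

/-- The uncentred maximal function of `g` over order intervals: the supremum of the averages of `g`
over the intervals `[a, b]` with `x` in their interior. On `ℝ` this is the one-dimensional maximal
function, and on `Fin n → ℝ`, whose intervals are the closed boxes, the strong one. -/
noncomputable def intervalMaximal {α : Type*} [Preorder α] [TopologicalSpace α] [MeasureSpace α]
    (g : α → ℝ≥0∞) (x : α) : ℝ≥0∞ :=
  ⨆ (a : α) (b : α) (_ : x ∈ interior (Set.Icc a b)), ⨍⁻ y in Set.Icc a b, g y ∂volume

section IntervalMaximal

variable {α : Type*} [Preorder α] [TopologicalSpace α] [MeasureSpace α] {g h : α → ℝ≥0∞}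

theorem setLAverage_le_intervalMaximal {a b x : α} (hx : x ∈ interior (Set.Icc a b)) :
    ⨍⁻ y in Set.Icc a b, g y ∂volume ≤ intervalMaximal g x :=
  le_iSup₂_of_le a b (le_iSup_of_le hx le_rfl)

theorem intervalMaximal_le {x : α} {C : ℝ≥0∞}
    (hC : ∀ a b, x ∈ interior (Set.Icc a b) → ⨍⁻ y in Set.Icc a b, g y ∂volume ≤ C) :
    intervalMaximal g x ≤ C :=
  iSup₂_le fun a b => iSup_le (hC a b)

theorem lt_intervalMaximal_iff {x : α} {t : ℝ≥0∞} :
    t < intervalMaximal g x ↔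
      ∃ a b, x ∈ interior (Set.Icc a b) ∧ t < ⨍⁻ y in Set.Icc a b, g y ∂volume := by
  simp only [intervalMaximal, lt_iSup_iff, exists_prop]

theorem lowerSemicontinuous_intervalMaximal : LowerSemicontinuous (intervalMaximal g) := by
  intro x t ht
  obtain ⟨a, b, hx, hlt⟩ := lt_intervalMaximal_iff.1 ht
  filter_upwards [isOpen_interior.mem_nhds hx] with y hy
  exact lt_intervalMaximal_iff.2 ⟨a, b, hy, hlt⟩

theorem measurable_intervalMaximal [OpensMeasurableSpace α] : Measurable (intervalMaximal g) :=
  lowerSemicontinuous_intervalMaximal.measurable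

theorem intervalMaximal_mono (hgh : g ≤ h) : intervalMaximal g ≤ intervalMaximal h := fun _ =>
  intervalMaximal_le fun _ _ hx =>
    (lintegral_mono hgh).trans (setLAverage_le_intervalMaximal hx)

theorem intervalMaximal_congr_ae (hgh : g =ᵐ[volume] h) :
    intervalMaximal g = intervalMaximal h := by
  ext x
  refine iSup_congr fun a => iSup_congr fun b => iSup_congr fun _ => ?_
  exact laverage_congr (ae_restrict_of_ae hgh)

theorem intervalMaximal_le_of_le {K : ℝ≥0∞} (hK : ∀ x, g x ≤ K) (x : α) :
    intervalMaximal g x ≤ K := by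
  refine intervalMaximal_le fun a b _ => ?_
  rw [setLAverage_eq]
  refine ENNReal.div_le_of_le_mul ?_
  rw [← setLIntegral_const]
  exact lintegral_mono hK

theorem intervalMaximal_iSup {g : ℕ → α → ℝ≥0∞} (hg : ∀ k, Measurable (g k)) (hmono : Monotone g)
    (x : α) : intervalMaximal (fun y => ⨆ k, g k y) x = ⨆ k, intervalMaximal (g k) x := by
  refine le_antisymm (intervalMaximal_le fun a b hx => ?_)
    (iSup_le fun k => intervalMaximal_mono (fun y => le_iSup (g · y) k) x)
  rw [setLAverage_eq, lintegral_iSup hg hmono, ENNReal.iSup_div]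
  refine iSup_mono fun k => ?_
  rw [← setLAverage_eq]
  exact setLAverage_le_intervalMaximal hx

end IntervalMaximal

theorem strongMaximal_eq_intervalMaximal {n : ℕ} {𝕜 : Type*} [RCLike 𝕜] (f : (Fin n → ℝ) → 𝕜) :
    strongMaximal f = intervalMaximal fun y => ‖f y‖ₑ := by
  ext x
  refine iSup_congr fun a => iSup_congr fun b => iSup_congr_Prop ?_ fun _ => ?_
  · simp [← Set.pi_univ_Icc, interior_pi_set Set.finite_univ, interior_Icc]
  · rw [setLAverage_eq, Real.volume_Icc_pi, ENNReal.div_eq_inv_mul]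

theorem mul_measure_add_le_of_isCompact {g : ℝ → ℝ≥0∞} (hg : Measurable g)
    (hfin : ∫⁻ y, g y ≠ ∞) {t : ℝ≥0∞} {K : Set ℝ} (hK : IsCompact K)
    (hKt : K ⊆ {x | t < intervalMaximal g x}) :
    t * volume K + t * volume {x | t < g x} ≤
      (∫⁻ y in {x | t < intervalMaximal g x}, g y) + ∫⁻ y in {x | t < g x}, g y := by
  choose! a b hab hlt using fun x (hx : x ∈ K) => lt_intervalMaximal_iff.1 (hKt hx)
  simp only [interior_Icc] at hab
  obtain ⟨s, hsK, hs⟩ := hK.elim_nhds_subcover (fun x => Set.Ioo (a x) (b x))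
    fun x hx => isOpen_Ioo.mem_nhds (hab x hx)
  obtain ⟨u, hus, hunion, hover⟩ := exists_subfamily_biUnion_Ioo_eq s a b
  have hmass (x) (hx : x ∈ u) :
      t * volume (Set.Ioo (a x) (b x)) ≤ ∫⁻ y in Set.Ioo (a x) (b x), g y := by
    rw [Measure.restrict_congr_set Ioo_ae_eq_Icc, measure_congr Ioo_ae_eq_Icc,
      ← measure_mul_setLAverage _ measure_Icc_lt_top.ne, mul_comm]
    gcongr
    exact (hlt x (hsK x (hus hx))).le
  have hsub : ⋃ x ∈ u, Set.Ioo (a x) (b x) ⊆ {x | t < intervalMaximal g x} :=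
    Set.iUnion₂_subset fun x hx y hy =>
      lt_intervalMaximal_iff.2 ⟨_, _, by rwa [interior_Icc], hlt x (hsK x (hus hx))⟩
  calc t * volume K + t * volume {x | t < g x}
      ≤ t * volume (⋃ x ∈ u, Set.Ioo (a x) (b x)) + t * volume {x | t < g x} := by
        gcongr
        exact hunion ▸ hs
    _ ≤ (∫⁻ y in ⋃ x ∈ u, Set.Ioo (a x) (b x), g y) + ∫⁻ y in {x | t < g x}, g y :=
        mul_measure_biUnion_add_le u (fun _ _ => measurableSet_Ioo) hover hg hfin hmass
    _ ≤ _ := by gcongr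

theorem mul_measure_lt_intervalMaximal_add_le {g : ℝ → ℝ≥0∞} (hg : Measurable g)
    (hfin : ∫⁻ y, g y ≠ ∞) (t : ℝ≥0∞) :
    t * volume {x | t < intervalMaximal g x} + t * volume {x | t < g x} ≤
      (∫⁻ y in {x | t < intervalMaximal g x}, g y) + ∫⁻ y in {x | t < g x}, g y := by
  have hopen : IsOpen {x | t < intervalMaximal g x} :=
    lowerSemicontinuous_intervalMaximal.isOpen_preimage t
  rw [hopen.measure_eq_iSup_isCompact]
  simp_rw [iSup_and', ENNReal.mul_iSup]
  rw [ENNReal.biSup_add' ⟨∅, Set.empty_subset _, isCompact_empty⟩]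
  exact iSup₂_le fun K hK => mul_measure_add_le_of_isCompact hg hfin hK.2 hK.1

theorem exists_monotone_truncation {α : Type*} [MeasurableSpace α] (μ : Measure α) [SigmaFinite μ]
    {g : α → ℝ≥0∞} (hg : Measurable g) :
    ∃ h : ℕ → α → ℝ≥0∞, (∀ k, Measurable (h k)) ∧ Monotone h ∧ (∀ k x, h k x ≤ k) ∧
      (∀ k, ∫⁻ x, h k x ∂μ ≠ ∞) ∧ ∀ x, ⨆ k, h k x = g x := by
  refine ⟨fun k => (spanningSets μ k).indicator fun x => min (g x) k,
    fun k => (hg.min measurable_const).indicator (measurableSet_spanningSets μ k),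
    fun k l hkl x => ?_, fun k x => ?_, fun k => ?_, fun x => ?_⟩
  · calc (spanningSets μ k).indicator (fun x => min (g x) k) x
        ≤ (spanningSets μ l).indicator (fun x => min (g x) k) x :=
          Set.indicator_le_indicator_of_subset (monotone_spanningSets μ hkl) (fun _ => zero_le) x
      _ ≤ (spanningSets μ l).indicator (fun x => min (g x) l) x := by
          refine Set.indicator_le_indicator ?_
          gcongr
  · exact (Set.indicator_le_self _ _ x).trans (min_le_right _ _)
  · rw [lintegral_indicator (measurableSet_spanningSets μ k)]
    refine ne_top_of_le_ne_top ?_ (setLIntegral_mono measurable_const fun x _ => min_le_right _ _)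
    rw [setLIntegral_const]
    exact ENNReal.mul_ne_top (by simp) (measure_spanningSets_lt_top μ k).ne
  · refine le_antisymm (iSup_le fun k => (Set.indicator_le_self _ _ x).trans (min_le_left _ _))
      (le_of_forall_lt fun d hd => ?_)
    obtain ⟨k, hk⟩ := ENNReal.exists_nat_gt hd.ne_top
    refine lt_of_lt_of_le ?_ (le_iSup _ (max k (spanningSetsIndex μ x)))
    dsimp only
    rw [Set.indicator_of_mem (monotone_spanningSets μ (le_max_right _ _)
      (mem_spanningSetsIndex μ x))]
    exact lt_min hd (hk.trans_le (by exact_mod_cast le_max_left _ _))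

theorem lintegral_intervalMaximal_rpow_le {g : ℝ → ℝ≥0∞} (hg : Measurable g) {p c : ℝ}
    (hp : 1 < p) (hc : IsMaximalConst p c) :
    ∫⁻ x, intervalMaximal g x ^ p ≤ ENNReal.ofReal (c ^ p) * ∫⁻ x, g x ^ p := by
  have hp0 : 0 < p := by linarith
  obtain ⟨h, hhm, hmono, hbdd, hint, hsup⟩ := exists_monotone_truncation volume hg
  have hpow (x : ℝ) : intervalMaximal g x ^ p = ⨆ k, intervalMaximal (h k) x ^ p := by
    rw [← funext hsup, intervalMaximal_iSup hhm hmono]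
    exact (ENNReal.orderIsoRpow p hp0).map_iSup _
  simp_rw [hpow]
  rw [lintegral_iSup (fun k => measurable_intervalMaximal.pow_const _) fun k l hkl x =>
    ENNReal.rpow_le_rpow (intervalMaximal_mono (hmono hkl) x) hp0.le]
  refine iSup_le fun k => ?_
  calc ∫⁻ x, intervalMaximal (h k) x ^ p
      ≤ ENNReal.ofReal (c ^ p) * ∫⁻ x, h k x ^ p :=
        lintegral_rpow_le_of_weakType measurable_intervalMaximal (hhm k)
          (intervalMaximal_le_of_le (hbdd k)) (hbdd k) (ENNReal.natCast_ne_top k) (hint k) hp hc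
          (mul_measure_lt_intervalMaximal_add_le (hhm k) (hint k))
    _ ≤ ENNReal.ofReal (c ^ p) * ∫⁻ x, g x ^ p := by
        gcongr with x
        exact hsup x ▸ le_iSup (h · x) k

section RealLine

variable {g : ℝ → ℝ≥0∞}

theorem exists_pos_forall_lt_setLAverage {a b : ℝ} {d : ℝ≥0∞}
    (hd : d < ⨍⁻ y in Set.Icc a b, g y ∂volume) :
    ∃ δ > 0, ∀ a' ∈ Set.Ioc (a - δ) a, ∀ b' ∈ Set.Ico b (b + δ),
      d < ⨍⁻ y in Set.Icc a' b', g y ∂volume := by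
  simp_rw [setLAverage_eq, Real.volume_Icc] at hd ⊢
  have hcont : Filter.Tendsto
      (fun u => (∫⁻ y in Set.Icc a b, g y) / ENNReal.ofReal u) (nhds (b - a))
      (nhds ((∫⁻ y in Set.Icc a b, g y) / ENNReal.ofReal (b - a))) :=
    ENNReal.Tendsto.const_div (ENNReal.continuous_ofReal.tendsto _) (Or.inl ENNReal.ofReal_ne_top)
  obtain ⟨δ, hδ, hball⟩ := Metric.eventually_nhds_iff.1 (hcont.eventually_const_lt hd)
  refine ⟨δ / 2, half_pos hδ, fun a' ha' b' hb' => ?_⟩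
  have hdist : dist (b' - a') (b - a) < δ := by
    rw [Real.dist_eq, abs_lt]
    constructor <;> linarith [ha'.1, ha'.2, hb'.1, hb'.2]
  refine (hball hdist).trans_le ?_
  gcongr
  exacts [ha'.2, hb'.1]

theorem setLAverage_le_intervalMaximal_of_mem_Icc {a b x : ℝ} (hx : x ∈ Set.Icc a b) :
    ⨍⁻ y in Set.Icc a b, g y ∂volume ≤ intervalMaximal g x := by
  refine le_of_forall_lt fun d hd => ?_
  obtain ⟨δ, hδ, hlt⟩ := exists_pos_forall_lt_setLAverage hd
  refine lt_intervalMaximal_iff.2 ⟨a - δ / 2, b + δ / 2, ?_, hlt _ ?_ _ ?_⟩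
  · rw [interior_Icc]
    constructor <;> linarith [hx.1, hx.2]
  · constructor <;> linarith
  · constructor <;> linarith

theorem intervalMaximal_eq_iSup_rat (x : ℝ) :
    intervalMaximal g x = ⨆ (q : ℚ) (r : ℚ) (_ : x ∈ Set.Ioo (q : ℝ) r),
      ⨍⁻ y in Set.Icc (q : ℝ) r, g y ∂volume := by
  refine le_antisymm (le_of_forall_lt fun d hd => ?_) ?_
  · obtain ⟨a, b, hx, hlt⟩ := lt_intervalMaximal_iff.1 hd
    rw [interior_Icc] at hx
    obtain ⟨δ, hδ, hlt⟩ := exists_pos_forall_lt_setLAverage hlt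
    obtain ⟨q, hq, hqa⟩ := exists_rat_btwn (sub_lt_self a hδ)
    obtain ⟨r, hbr, hr⟩ := exists_rat_btwn (lt_add_of_pos_right b hδ)
    simp only [lt_iSup_iff]
    exact ⟨q, r, ⟨hqa.trans hx.1, hx.2.trans hbr⟩, hlt q ⟨hq, hqa.le⟩ r ⟨hbr.le, hr⟩⟩
  · exact iSup₂_le fun q r => iSup_le fun h =>
      setLAverage_le_intervalMaximal (by rwa [interior_Icc])

theorem measurable_intervalMaximal_fst {β : Type*} [MeasurableSpace β] {g : ℝ × β → ℝ≥0∞}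
    (hg : Measurable g) :
    Measurable fun z : ℝ × β => intervalMaximal (fun t => g (t, z.2)) z.1 := by
  classical
  simp_rw [intervalMaximal_eq_iSup_rat, iSup_eq_if, setLAverage_eq]
  refine Measurable.iSup fun q => Measurable.iSup fun r =>
    Measurable.ite (measurable_fst measurableSet_Ioo) (Measurable.div_const ?_ _) measurable_const
  exact (hg.lintegral_prod_left' (μ := volume.restrict (Set.Icc (q : ℝ) r))).comp measurable_snd

end RealLine

section Prod

theorem setLAverage_prod_symm {α β : Type*} [MeasurableSpace α] [MeasurableSpace β]
    {μ : Measure α} {ν : Measure β} [SFinite μ] [SFinite ν] {g : α × β → ℝ≥0∞}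
    (hg : Measurable g) (s : Set α) (t : Set β) :
    ⨍⁻ z in s ×ˢ t, g z ∂μ.prod ν = ⨍⁻ y in t, ⨍⁻ x in s, g (x, y) ∂μ ∂ν := by
  by_cases hs : μ s = 0
  · simp [Measure.restrict_eq_zero.2 hs, ← Measure.prod_restrict]
  by_cases ht : ν t = 0
  · simp [Measure.restrict_eq_zero.2 ht, ← Measure.prod_restrict]
  simp only [setLAverage_eq, Measure.prod_prod, div_eq_mul_inv]
  rw [setLIntegral_prod_symm _ hg.aemeasurable, ENNReal.mul_inv (.inl hs) (.inr ht),
    lintegral_mul_const' _ _ (ENNReal.inv_ne_top.2 hs), mul_assoc]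

theorem mem_interior_Icc_prod {α β : Type*} [Preorder α] [TopologicalSpace α] [Preorder β]
    [TopologicalSpace β] {a b z : α × β} :
    z ∈ interior (Set.Icc a b) ↔
      z.1 ∈ interior (Set.Icc a.1 b.1) ∧ z.2 ∈ interior (Set.Icc a.2 b.2) := by
  rw [Set.Icc_prod_eq, interior_prod_eq, Set.mem_prod]

theorem setLAverage_Icc_prod {α β : Type*} [Preorder α] [MeasureSpace α] [Preorder β]
    [MeasureSpace β] [SFinite (volume : Measure α)] [SFinite (volume : Measure β)]
    {g : α × β → ℝ≥0∞} (hg : Measurable g) (a b : α × β) :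
    ⨍⁻ z in Set.Icc a b, g z ∂volume =
      ⨍⁻ y in Set.Icc a.2 b.2, ⨍⁻ x in Set.Icc a.1 b.1, g (x, y) ∂volume ∂volume := by
  rw [Set.Icc_prod_eq, Measure.volume_eq_prod, setLAverage_prod_symm hg]

variable {α β : Type*} [Preorder α] [TopologicalSpace α] [MeasureSpace α]
  [Preorder β] [TopologicalSpace β] [MeasureSpace β]

theorem intervalMaximal_prod_le [SFinite (volume : Measure α)] [SFinite (volume : Measure β)]
    {g : α × β → ℝ≥0∞} (hg : Measurable g) (z : α × β) :
    intervalMaximal g z ≤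
      intervalMaximal (fun y => intervalMaximal (fun x => g (x, y)) z.1) z.2 := by
  refine intervalMaximal_le fun a b hz => ?_
  rw [mem_interior_Icc_prod] at hz
  rw [setLAverage_Icc_prod hg]
  exact (lintegral_mono fun y => setLAverage_le_intervalMaximal hz.1).trans
    (setLAverage_le_intervalMaximal hz.2)

theorem intervalMaximal_mul_intervalMaximal_le [SFinite (volume : Measure α)]
    [SFinite (volume : Measure β)] {g : α → ℝ≥0∞} {h : β → ℝ≥0∞} (hg : Measurable g)
    (hh : Measurable h) (z : α × β) :
    intervalMaximal g z.1 * intervalMaximal h z.2 ≤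
      intervalMaximal (fun w => g w.1 * h w.2) z := by
  simp only [intervalMaximal, ENNReal.iSup_mul, ENNReal.mul_iSup]
  refine iSup₂_le fun a' b' => iSup_le fun hz₂ => iSup₂_le fun a b => iSup_le fun hz₁ => ?_
  calc (⨍⁻ x in Set.Icc a b, g x ∂volume) * ⨍⁻ y in Set.Icc a' b', h y ∂volume
      = ⨍⁻ w in Set.Icc (a, a') (b, b'), g w.1 * h w.2 ∂volume := by
        rw [setLAverage_Icc_prod (by fun_prop)]
        simp only [laverage]
        simp_rw [lintegral_mul_const _ hg]
        rw [lintegral_const_mul _ hh]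
    _ ≤ intervalMaximal (fun w => g w.1 * h w.2) z :=
        setLAverage_le_intervalMaximal (mem_interior_Icc_prod.2 ⟨hz₁, hz₂⟩)

theorem lintegral_intervalMaximal_prod_rpow_le [SFinite (volume : Measure β)] {p : ℝ}
    (hp : 0 ≤ p) {A B : ℝ≥0∞}
    (hA : ∀ g : ℝ → ℝ≥0∞, Measurable g →
      ∫⁻ x, intervalMaximal g x ^ p ≤ A * ∫⁻ x, g x ^ p)
    (hB : ∀ g : β → ℝ≥0∞, Measurable g →
      ∫⁻ y, intervalMaximal g y ^ p ≤ B * ∫⁻ y, g y ^ p)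
    {g : ℝ × β → ℝ≥0∞} (hg : Measurable g) :
    ∫⁻ z, intervalMaximal g z ^ p ≤ A * B * ∫⁻ z, g z ^ p := by
  let G : ℝ × β → ℝ≥0∞ := fun z => intervalMaximal (fun x => g (x, z.2)) z.1
  have hGm : Measurable G := measurable_intervalMaximal_fst hg
  have hgp : Measurable fun z => g z ^ p := hg.pow_const p
  have hGp : Measurable fun z => G z ^ p := hGm.pow_const p
  have hGpx : Measurable fun x => ∫⁻ y, G (x, y) ^ p := hGp.lintegral_prod_right'
  have hgpy : Measurable fun y => ∫⁻ x, g (x, y) ^ p := hgp.lintegral_prod_left'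
  calc ∫⁻ z, intervalMaximal g z ^ p
      ≤ ∫⁻ x, ∫⁻ y, intervalMaximal g (x, y) ^ p := lintegral_prod_le _
    _ ≤ ∫⁻ x, ∫⁻ y, intervalMaximal (fun y => G (x, y)) y ^ p := by
        gcongr with x y
        exact intervalMaximal_prod_le hg (x, y)
    _ ≤ ∫⁻ x, B * ∫⁻ y, G (x, y) ^ p :=
        lintegral_mono fun x =>
          hB (fun y => G (x, y)) (hGm.comp measurable_prodMk_left)
    _ = B * ∫⁻ y, ∫⁻ x, G (x, y) ^ p := by
        rw [lintegral_const_mul _ hGpx]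
        congr 1
        exact lintegral_lintegral_swap hGp.aemeasurable
    _ ≤ B * ∫⁻ y, A * ∫⁻ x, g (x, y) ^ p := by
        gcongr with y
        exact hA (fun x => g (x, y)) (hg.comp measurable_prodMk_right)
    _ = A * B * ∫⁻ z, g z ^ p := by
        rw [lintegral_const_mul _ hgpy, Measure.volume_eq_prod,
          lintegral_prod_symm _ hgp.aemeasurable]
        ring

theorem intervalMaximal_comp_orderIso (e : α ≃o β) (he : IsHomeomorph e)
    (hem : MeasurableEmbedding e) (hev : MeasurePreserving e) (g : β → ℝ≥0∞) (x : α) :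
    intervalMaximal (g ∘ e) x = intervalMaximal g (e x) := by
  refine e.toEquiv.iSup_congr fun a => (e.toEquiv.iSup_congr fun b => ?_).symm
  have hpre : e ⁻¹' Set.Icc (e a) (e b) = Set.Icc a b := by
    simp
  have hmem : x ∈ interior (Set.Icc a b) ↔ e x ∈ interior (Set.Icc (e a) (e b)) := by
    rw [← hpre, ← he.isOpenMap.preimage_interior_eq_interior_preimage he.continuous,
      Set.mem_preimage]
  have havg : ⨍⁻ y in Set.Icc a b, (g ∘ e) y ∂volume =
      ⨍⁻ y in Set.Icc (e a) (e b), g y ∂volume := by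
    simp only [setLAverage_eq, ← hpre]
    rw [← hev.setLIntegral_comp_preimage_emb hem, hev.measure_preimage_emb hem]
    rfl
  exact iSup_congr_Prop hmem.symm fun _ => havg.symm

end Prod

section Fin

variable {n : ℕ}

theorem measurePreserving_consOrderIso :
    MeasurePreserving (Fin.consOrderIso fun _ : Fin (n + 1) => ℝ) := by
  rw [← Fin.insertNthOrderIso_zero]
  exact (volume_preserving_piFinSuccAbove (fun _ => ℝ) 0).symm

theorem isHomeomorph_consOrderIso : IsHomeomorph (Fin.consOrderIso fun _ : Fin (n + 1) => ℝ) :=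
  (Fin.consEquivL ℝ fun _ : Fin (n + 1) => ℝ).toHomeomorph.isHomeomorph

theorem measurableEmbedding_consOrderIso :
    MeasurableEmbedding (Fin.consOrderIso fun _ : Fin (n + 1) => ℝ) :=
  (Fin.consEquivL ℝ fun _ : Fin (n + 1) => ℝ).toHomeomorph.measurableEmbedding

theorem intervalMaximal_cons (g : (Fin (n + 1) → ℝ) → ℝ≥0∞) (z : ℝ × (Fin n → ℝ)) :
    intervalMaximal (fun w : ℝ × (Fin n → ℝ) => g (Fin.cons w.1 w.2)) z =
      intervalMaximal g (Fin.cons z.1 z.2) :=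
  intervalMaximal_comp_orderIso (Fin.consOrderIso fun _ : Fin (n + 1) => ℝ)
    isHomeomorph_consOrderIso measurableEmbedding_consOrderIso measurePreserving_consOrderIso g z

theorem lintegral_comp_cons (g : (Fin (n + 1) → ℝ) → ℝ≥0∞) :
    ∫⁻ z : ℝ × (Fin n → ℝ), g (Fin.cons z.1 z.2) = ∫⁻ x, g x :=
  measurePreserving_consOrderIso.lintegral_comp_emb measurableEmbedding_consOrderIso g

theorem lintegral_intervalMaximal_pi_rpow_le {p c : ℝ} (hp : 1 < p) (hc : IsMaximalConst p c)
    (n : ℕ) {g : (Fin n → ℝ) → ℝ≥0∞} (hg : Measurable g) :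
    ∫⁻ x, intervalMaximal g x ^ p ≤ ENNReal.ofReal (c ^ p) ^ n * ∫⁻ x, g x ^ p := by
  have hp0 : 0 ≤ p := by linarith
  induction n with
  | zero =>
    have hg_le (y x : Fin 0 → ℝ) : g y ≤ g x := by rw [Subsingleton.elim y x]
    rw [pow_zero, one_mul]
    gcongr with x
    exact intervalMaximal_le_of_le (fun y => hg_le y x) x
  | succ n ih =>
    have hcons : Measurable fun w : ℝ × (Fin n → ℝ) => g (Fin.cons w.1 w.2) :=
      hg.comp measurableEmbedding_consOrderIso.measurable
    rw [← lintegral_comp_cons fun x => intervalMaximal g x ^ p,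
      ← lintegral_comp_cons fun x => g x ^ p, pow_succ']
    simp_rw [← intervalMaximal_cons]
    exact lintegral_intervalMaximal_prod_rpow_le hp0
      (fun _ hg => lintegral_intervalMaximal_rpow_le hg hp hc) (fun _ hg => ih hg) hcons

theorem eLpNorm_strongMaximal_le {𝕜 : Type*} [RCLike 𝕜] {p c : ℝ} (hp : 1 < p)
    (hc : IsMaximalConst p c) {f : (Fin n → ℝ) → 𝕜} (hf : AEStronglyMeasurable f volume) :
    eLpNorm (strongMaximal f) (ENNReal.ofReal p) volume ≤
      ENNReal.ofReal (c ^ n) * eLpNorm f (ENNReal.ofReal p) volume := by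
  have hp0 : 0 < p := by linarith
  have hpE : ENNReal.ofReal p ≠ 0 := by simpa using hp0
  have hc0 : 0 < c := hc.pos
  rw [strongMaximal_eq_intervalMaximal, intervalMaximal_congr_ae hf.enorm.ae_eq_mk,
    ← eLpNorm_enorm f, eLpNorm_congr_ae hf.enorm.ae_eq_mk]
  simp only [eLpNorm_eq_lintegral_rpow_enorm_toReal hpE ENNReal.ofReal_ne_top,
    ENNReal.toReal_ofReal hp0.le, enorm_eq_self, one_div]
  rw [ENNReal.rpow_inv_le_iff hp0, ENNReal.mul_rpow_of_nonneg _ _ hp0.le,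
    ENNReal.rpow_inv_rpow hp0.ne', ENNReal.ofReal_rpow_of_nonneg (by positivity) hp0.le,
    ← Real.rpow_pow_comm hc0.le, ENNReal.ofReal_pow (by positivity)]
  exact lintegral_intervalMaximal_pi_rpow_le hp hc n hf.enorm.measurable_mk

theorem lpOperatorNorm_strongMaximal_le {𝕜 : Type*} [RCLike 𝕜] {p c : ℝ} (hp : 1 < p)
    (hc : IsMaximalConst p c) :
    lpOperatorNorm (strongMaximal (n := n) (𝕜 := 𝕜)) (ENNReal.ofReal p) volume ≤
      ENNReal.ofReal (c ^ n) :=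
  sInf_le fun _ hf => eLpNorm_strongMaximal_le hp hc hf.1

theorem memLp_strongMaximal {𝕜 : Type*} [RCLike 𝕜] {p : ℝ} (hp : 1 < p) {f : (Fin n → ℝ) → 𝕜}
    (hf : MemLp f (ENNReal.ofReal p) volume) :
    MemLp (strongMaximal f) (ENNReal.ofReal p) volume := by
  obtain ⟨c, hc, -⟩ := existsUnique_isMaximalConst hp
  refine ⟨?_, (eLpNorm_strongMaximal_le hp hc hf.1).trans_lt
    (ENNReal.mul_lt_top ENNReal.ofReal_lt_top hf.2)⟩
  rw [strongMaximal_eq_intervalMaximal]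
  exact measurable_intervalMaximal.aestronglyMeasurable

end Fin

theorem le_lpOperatorNorm {α 𝕜 : Type*} [MeasurableSpace α] [RCLike 𝕜]
    {T : (α → 𝕜) → α → ℝ≥0∞} {p : ℝ≥0∞} {μ : Measure α} {f : α → 𝕜} {K : ℝ≥0∞}
    (hKtop : K ≠ ∞) (hf : MemLp f p μ) (hf0 : eLpNorm f p μ ≠ 0)
    (hK : ∀ x, K * ‖f x‖ₑ ≤ T f x) :
    K ≤ lpOperatorNorm T p μ := by
  lift K to NNReal using hKtop
  refine le_sInf fun C hC => (ENNReal.mul_le_mul_iff_left hf0 hf.2.ne).1 ?_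
  calc K * eLpNorm f p μ = eLpNorm ((K : ℝ) • f) p μ := by simp [eLpNorm_const_smul]
    _ ≤ eLpNorm (T f) p μ := eLpNorm_mono_enorm fun x => by simpa [enorm_smul] using hK x
    _ ≤ C * eLpNorm f p μ := hC f hf

section Product

variable {n : ℕ} {h : ℝ → ℝ≥0∞}

theorem lintegral_fin_prod_eq_pow (hh : Measurable h) (n : ℕ) :
    ∫⁻ x : Fin n → ℝ, ∏ i, h (x i) = (∫⁻ x, h x) ^ n := by
  induction n with
  | zero => simp [volume_pi]
  | succ n ih =>
    rw [← lintegral_comp_cons fun x => ∏ i, h (x i), pow_succ', ← ih]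
    simp_rw [Fin.prod_univ_succ, Fin.cons_zero, Fin.cons_succ]
    have hprod : Measurable fun y : Fin n → ℝ => ∏ i, h (y i) := by fun_prop
    exact lintegral_prod_mul hh.aemeasurable hprod.aemeasurable

theorem prod_intervalMaximal_le (hh : Measurable h) (x : Fin n → ℝ) :
    ∏ i, intervalMaximal h (x i) ≤ intervalMaximal (fun y : Fin n → ℝ => ∏ i, h (y i)) x := by
  induction n with
  | zero =>
    have hx : x ∈ interior (Set.Icc x x) := by
      rw [(isOpen_discrete _).interior_eq]
      exact Set.left_mem_Icc.2 le_rfl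
    refine le_trans ?_ (setLAverage_le_intervalMaximal hx)
    simp only [Finset.univ_eq_empty, Finset.prod_empty]
    rw [setLAverage_eq, setLIntegral_one, Real.volume_Icc_pi]
    simp
  | succ n ih =>
    have hcons := intervalMaximal_cons (fun y => ∏ i, h (y i)) (x 0, Fin.tail x)
    simp_rw [Fin.prod_univ_succ, Fin.cons_zero, Fin.cons_succ, Fin.cons_self_tail] at hcons ⊢
    rw [← hcons]
    calc intervalMaximal h (x 0) * ∏ i, intervalMaximal h (Fin.tail x i)
        ≤ intervalMaximal h (x 0) *
            intervalMaximal (fun y : Fin n → ℝ => ∏ i, h (y i)) (Fin.tail x) := by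
          gcongr
          exact ih _
      _ ≤ _ := intervalMaximal_mul_intervalMaximal_le hh (by fun_prop) (x 0, Fin.tail x)

end Product

theorem setLIntegral_Icc_zero_abs_rpow {α u : ℝ} (hα : α < 1) (hu : 0 ≤ u) :
    ∫⁻ y in Set.Icc 0 u, ENNReal.ofReal (|y| ^ (-α)) = ENNReal.ofReal (u ^ (1 - α) / (1 - α)) := by
  have hint : IntegrableOn (fun y : ℝ => y ^ (-α)) (Set.Ioc 0 u) := by
    rw [← intervalIntegrable_iff_integrableOn_Ioc_of_le hu]
    exact intervalIntegral.intervalIntegrable_rpow' (by linarith)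
  have hval : ∫ y in Set.Ioc 0 u, y ^ (-α) = u ^ (1 - α) / (1 - α) := by
    rw [← intervalIntegral.integral_of_le hu, integral_rpow (Or.inl (by linarith)),
      Real.zero_rpow (by linarith), sub_zero, neg_add_eq_sub]
  rw [setLIntegral_congr Ioc_ae_eq_Icc.symm, ← hval,
    ofReal_integral_eq_lintegral_ofReal hint ((ae_restrict_mem measurableSet_Ioc).mono
      fun y hy => Real.rpow_nonneg hy.1.le _)]
  exact setLIntegral_congr_fun measurableSet_Ioc fun y hy => by simp only [abs_of_pos hy.1]

theorem setLIntegral_Icc_neg_abs_rpow {α u v : ℝ} (hα : α < 1) (hu : 0 ≤ u) (hv : 0 ≤ v) :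
    ∫⁻ y in Set.Icc (-u) v, ENNReal.ofReal (|y| ^ (-α)) =
      ENNReal.ofReal ((u ^ (1 - α) + v ^ (1 - α)) / (1 - α)) := by
  have hneg : ∫⁻ y in Set.Icc (-u) 0, ENNReal.ofReal (|y| ^ (-α)) =
      ∫⁻ y in Set.Icc 0 u, ENNReal.ofReal (|y| ^ (-α)) := by
    rw [← (Measure.measurePreserving_neg (volume : Measure ℝ)).setLIntegral_comp_preimage_emb
      (MeasurableEquiv.neg ℝ).measurableEmbedding _ (Set.Icc 0 u)]
    simp
  rw [← Set.Ico_union_Icc_eq_Icc (neg_nonpos.2 hu) hv, lintegral_union measurableSet_Icc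
    (Set.disjoint_left.2 fun y hy hy' => hy'.1.not_gt hy.2), setLIntegral_congr Ico_ae_eq_Icc,
    hneg, setLIntegral_Icc_zero_abs_rpow hα hu, setLIntegral_Icc_zero_abs_rpow hα hv,
    ← ENNReal.ofReal_add (by positivity) (by positivity), add_div]

/-- The truncated power `|x| ^ (-α)` on `[-1, 1]`, extended by zero. It is nearly extremal for the
one-dimensional maximal function on `L^p` when `α` is slightly smaller than `1 / p`. -/
noncomputable def truncPow (α : ℝ) : ℝ → ℝ :=
  (Set.Icc (-1) 1).indicator fun x => |x| ^ (-α)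

section TruncPow

variable {α : ℝ}

theorem truncPow_nonneg (x : ℝ) : 0 ≤ truncPow α x :=
  Set.indicator_nonneg (fun _ _ => by positivity) x

theorem truncPow_of_abs_le {x : ℝ} (hx : |x| ≤ 1) : truncPow α x = |x| ^ (-α) :=
  Set.indicator_of_mem (Set.mem_Icc.2 (abs_le.1 hx)) _

theorem truncPow_of_one_lt_abs {x : ℝ} (hx : 1 < |x|) : truncPow α x = 0 :=
  Set.indicator_of_notMem (fun h => hx.not_ge (abs_le.2 (Set.mem_Icc.1 h))) _

@[fun_prop]
theorem measurable_truncPow : Measurable (truncPow α) :=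
  Measurable.indicator (by fun_prop) measurableSet_Icc

theorem lintegral_truncPow_rpow {p : ℝ} (hp : 0 < p) (hα : α * p < 1) :
    ∫⁻ x, ENNReal.ofReal (truncPow α x) ^ p = ENNReal.ofReal (2 / (1 - α * p)) := by
  have hpow (x : ℝ) : ENNReal.ofReal (truncPow α x) ^ p =
      (Set.Icc (-1) 1).indicator (fun x => ENNReal.ofReal (|x| ^ (-(α * p)))) x := by
    by_cases hx : x ∈ Set.Icc (-1) 1
    · rw [Set.indicator_of_mem hx, truncPow_of_abs_le (abs_le.2 hx),
        ENNReal.ofReal_rpow_of_nonneg (by positivity) hp.le, ← Real.rpow_mul (abs_nonneg x),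
        neg_mul]
    · rw [Set.indicator_of_notMem hx, truncPow, Set.indicator_of_notMem hx, ENNReal.ofReal_zero,
        ENNReal.zero_rpow_of_pos hp]
  simp_rw [hpow]
  rw [lintegral_indicator measurableSet_Icc,
    setLIntegral_Icc_neg_abs_rpow hα zero_le_one zero_le_one, Real.one_rpow, one_add_one_eq_two]

theorem setLAverage_Icc_truncPow {u v : ℝ} (hα : α < 1) (hu : 0 ≤ u) (hu1 : u ≤ 1) (hv : 0 ≤ v)
    (hv1 : v ≤ 1) (huv : 0 < u + v) :
    ⨍⁻ y in Set.Icc (-u) v, ENNReal.ofReal (truncPow α y) ∂volume =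
      ENNReal.ofReal ((u ^ (1 - α) + v ^ (1 - α)) / ((1 - α) * (u + v))) := by
  have hcongr : ∫⁻ y in Set.Icc (-u) v, ENNReal.ofReal (truncPow α y) =
      ∫⁻ y in Set.Icc (-u) v, ENNReal.ofReal (|y| ^ (-α)) :=
    setLIntegral_congr_fun measurableSet_Icc fun y hy => by
      rw [truncPow_of_abs_le (abs_le.2 ⟨by linarith [hy.1], hy.2.trans hv1⟩)]
  rw [setLAverage_eq, hcongr, setLIntegral_Icc_neg_abs_rpow hα hu hv, Real.volume_Icc,
    sub_neg_eq_add, add_comm v u, ← ENNReal.ofReal_div_of_pos huv, div_div]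

/-- The average of `|y| ^ (-α)` over `[-s, 1]`, and hence, by homogeneity, the factor by which
averaging over `[-s x, x]` enlarges this power at `x > 0`. -/
noncomputable def powAverage (α s : ℝ) : ℝ :=
  (1 + s ^ (1 - α)) / ((1 - α) * (1 + s))

theorem powAverage_mul_truncPow {s x : ℝ} (hs : 0 ≤ s) (hx0 : x ≠ 0) (hx1 : |x| ≤ 1) :
    powAverage α s * truncPow α x =
      (|x| ^ (1 - α) + (s * |x|) ^ (1 - α)) / ((1 - α) * (|x| + s * |x|)) := by
  have hx : 0 < |x| := abs_pos.2 hx0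
  rw [truncPow_of_abs_le hx1, powAverage, Real.mul_rpow hs hx.le,
    show (1 - α) * (|x| + s * |x|) = (1 - α) * (1 + s) * |x| by ring,
    show |x| ^ (1 - α) = |x| ^ (-α) * |x| by rw [← Real.rpow_add_one hx.ne', neg_add_eq_sub],
    show |x| ^ (-α) * |x| + s ^ (1 - α) * (|x| ^ (-α) * |x|) =
      (1 + s ^ (1 - α)) * |x| ^ (-α) * |x| by ring,
    mul_div_mul_right _ _ hx.ne', div_mul_eq_mul_div]

theorem powAverage_mul_truncPow_le_intervalMaximal {s : ℝ} (hα0 : α ≠ 0) (hα : α < 1)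
    (hs : 0 ≤ s) (hs1 : s ≤ 1) (x : ℝ) :
    ENNReal.ofReal (powAverage α s * truncPow α x) ≤
      intervalMaximal (fun y => ENNReal.ofReal (truncPow α y)) x := by
  rcases lt_or_ge 1 |x| with hx1 | hx1
  · simp [truncPow_of_one_lt_abs hx1]
  rcases eq_or_ne x 0 with rfl | hx0
  -- At the origin the convention `0 ^ (-α) = 0` makes `truncPow α` vanish.
  · simp [truncPow_of_abs_le hx1, Real.zero_rpow (neg_ne_zero.2 hα0)]
  have hx : 0 < |x| := abs_pos.2 hx0
  have hsx : 0 ≤ s * |x| := by positivity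
  have hsx1 : s * |x| ≤ 1 := mul_le_one₀ hs1 hx.le hx1
  rw [powAverage_mul_truncPow hs hx0 hx1]
  rcases le_total x 0 with hneg | hpos
  · rw [← setLAverage_Icc_truncPow hα hx.le hx1 hsx hsx1 (by positivity)]
    exact setLAverage_le_intervalMaximal_of_mem_Icc ⟨neg_abs_le x, hneg.trans hsx⟩
  · rw [add_comm (_ ^ _), add_comm |x|,
      ← setLAverage_Icc_truncPow hα hsx hsx1 hx.le hx1 (by positivity)]
    exact setLAverage_le_intervalMaximal_of_mem_Icc
      ⟨(neg_nonpos.2 hsx).trans hpos, le_abs_self x⟩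

theorem IsMaximalConst.powAverage_eq {p c : ℝ} (hp : 1 < p) (hc : IsMaximalConst p c) :
    powAverage (1 / p) (c ^ (-p)) = c := by
  have hp1 : 0 < p - 1 := by linarith
  have hc0 := hc.pos
  have hroot := (isMaximalConst_iff hc0).1 hc
  have hpow : (c ^ (-p)) ^ (1 - 1 / p) = (c ^ (p - 1))⁻¹ := by
    rw [← Real.rpow_mul hc0.le, ← Real.rpow_neg hc0.le]
    congr 1
    field_simp
  have hinv : c ^ (-p) = (c ^ (p - 1) * c)⁻¹ := by
    rw [← Real.rpow_add_one hc0.ne', sub_add_cancel, Real.rpow_neg hc0.le]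
  rw [powAverage, hpow, hinv]
  field_simp
  linear_combination -hroot

theorem IsMaximalConst.tendsto_powAverage {p c : ℝ} (hp : 1 < p) (hc : IsMaximalConst p c) :
    Filter.Tendsto (fun α => powAverage α (c ^ (-p))) (nhds (1 / p)) (nhds c) := by
  have hs : 0 < c ^ (-p) := Real.rpow_pos_of_pos hc.pos _
  have hp1 : 0 < 1 - 1 / p := by
    rw [sub_pos, div_lt_one (by linarith)]
    exact hp
  nth_rw 2 [← hc.powAverage_eq hp]
  refine ContinuousAt.div (continuousAt_const.add (continuousAt_const.rpow (by fun_prop)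
    (Or.inl hs.ne'))) (by fun_prop) (by positivity)

theorem enorm_ofReal_prod_truncPow {n : ℕ} (𝕜 : Type*) [RCLike 𝕜] (x : Fin n → ℝ) :
    ‖((∏ i, truncPow α (x i) : ℝ) : 𝕜)‖ₑ = ∏ i, ENNReal.ofReal (truncPow α (x i)) := by
  rw [← ofReal_norm, RCLike.norm_ofReal,
    abs_of_nonneg (Finset.prod_nonneg fun i _ => truncPow_nonneg _),
    ENNReal.ofReal_prod_of_nonneg fun i _ => truncPow_nonneg _]

theorem eLpNorm_prod_truncPow {p : ℝ} (hp : 0 < p) (hα : α * p < 1) (n : ℕ) (𝕜 : Type*)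
    [RCLike 𝕜] :
    eLpNorm (fun x : Fin n → ℝ => ((∏ i, truncPow α (x i) : ℝ) : 𝕜)) (ENNReal.ofReal p) volume =
      (ENNReal.ofReal (2 / (1 - α * p)) ^ n) ^ (1 / p) := by
  rw [eLpNorm_eq_lintegral_rpow_enorm_toReal (by simpa using hp) ENNReal.ofReal_ne_top,
    ENNReal.toReal_ofReal hp.le, ← lintegral_truncPow_rpow hp hα,
    ← lintegral_fin_prod_eq_pow (by fun_prop)]
  simp_rw [enorm_ofReal_prod_truncPow, ENNReal.prod_rpow_of_nonneg hp.le]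

theorem powAverage_pow_mul_prod_truncPow_le {n : ℕ} {s : ℝ} (hα0 : α ≠ 0) (hα : α < 1)
    (hs : 0 ≤ s) (hs1 : s ≤ 1) (x : Fin n → ℝ) :
    ENNReal.ofReal (powAverage α s) ^ n * ∏ i, ENNReal.ofReal (truncPow α (x i)) ≤
      intervalMaximal (fun y : Fin n → ℝ => ∏ i, ENNReal.ofReal (truncPow α (y i))) x := by
  calc ENNReal.ofReal (powAverage α s) ^ n * ∏ i, ENNReal.ofReal (truncPow α (x i))
      = ∏ i, ENNReal.ofReal (powAverage α s * truncPow α (x i)) := by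
        simp_rw [ENNReal.ofReal_mul' (truncPow_nonneg _), Finset.prod_mul_distrib]
        rw [Finset.prod_const, Finset.card_fin]
    _ ≤ ∏ i, intervalMaximal (fun y => ENNReal.ofReal (truncPow α y)) (x i) := by
        gcongr with i
        exact powAverage_mul_truncPow_le_intervalMaximal hα0 hα hs hs1 (x i)
    _ ≤ _ := prod_intervalMaximal_le (by fun_prop) x

theorem powAverage_pow_le_lpOperatorNorm {p s : ℝ} (hp : 1 < p) (hα0 : α ≠ 0) (hα : α * p < 1)
    (hs : 0 ≤ s) (hs1 : s ≤ 1) (n : ℕ) (𝕜 : Type*) [RCLike 𝕜] :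
    ENNReal.ofReal (powAverage α s) ^ n ≤
      lpOperatorNorm (strongMaximal (n := n) (𝕜 := 𝕜)) (ENNReal.ofReal p) volume := by
  have hp0 : 0 < p := by linarith
  have hα1 : α < 1 := by nlinarith
  have hmass : 0 < 2 / (1 - α * p) := div_pos two_pos (by linarith)
  have hnorm := eLpNorm_prod_truncPow hp0 hα n 𝕜
  have hmeas : Measurable fun x : Fin n → ℝ => ((∏ i, truncPow α (x i) : ℝ) : 𝕜) :=
    RCLike.measurable_ofReal.comp (by fun_prop)
  have hmem : MemLp (fun x : Fin n → ℝ => ((∏ i, truncPow α (x i) : ℝ) : 𝕜))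
      (ENNReal.ofReal p) volume := by
    refine ⟨hmeas.aestronglyMeasurable, hnorm.trans_lt ?_⟩
    exact ENNReal.rpow_lt_top_of_nonneg (by positivity) (by finiteness)
  refine le_lpOperatorNorm (by finiteness) hmem ?_ fun x => ?_
  · rw [hnorm]
    exact (ENNReal.rpow_pos (ENNReal.pow_pos (ENNReal.ofReal_pos.2 hmass) n)
      (by finiteness)).ne'
  · rw [strongMaximal_eq_intervalMaximal]
    simp_rw [enorm_ofReal_prod_truncPow]
    exact powAverage_pow_mul_prod_truncPow_le hα0 hα1 hs hs1 x

end TruncPow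

theorem le_lpOperatorNorm_strongMaximal {𝕜 : Type*} [RCLike 𝕜] {n : ℕ} {p c : ℝ} (hp : 1 < p)
    (hc : IsMaximalConst p c) :
    ENNReal.ofReal (c ^ n) ≤
      lpOperatorNorm (strongMaximal (n := n) (𝕜 := 𝕜)) (ENNReal.ofReal p) volume := by
  have hp0 : 0 < p := by linarith
  have hs : 0 ≤ c ^ (-p) := Real.rpow_nonneg hc.pos.le _
  have hs1 : c ^ (-p) ≤ 1 := Real.rpow_le_one_of_one_le_of_nonpos (hc.one_lt hp).le (by linarith)
  have hlim : Filter.Tendsto (fun α => ENNReal.ofReal (powAverage α (c ^ (-p))) ^ n)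
      (nhdsWithin (1 / p) (Set.Iio (1 / p))) (nhds (ENNReal.ofReal c ^ n)) :=
    (((ENNReal.continuous_pow n).comp ENNReal.continuous_ofReal).tendsto c).comp
      ((hc.tendsto_powAverage hp).mono_left nhdsWithin_le_nhds)
  rw [ENNReal.ofReal_pow hc.pos.le]
  refine le_of_tendsto hlim ?_
  filter_upwards [Ioo_mem_nhdsLT (one_div_pos.2 hp0)] with α hα
  exact powAverage_pow_le_lpOperatorNorm hp hα.1.ne' ((lt_div_iff₀ hp0).1 hα.2) hs hs1 n 𝕜

theorem mainTheorem2 {𝕜 : Type*} [RCLike 𝕜] (n : ℕ) (p : ℝ) (hp : 1 < p) :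
    (∃! c : ℝ, 0 < c ∧ (p - 1) * c ^ p - p * c ^ (p - 1) - 1 = 0) ∧
    (∀ f : (Fin n → ℝ) → 𝕜, MemLp f (ENNReal.ofReal p) volume →
      MemLp (strongMaximal f) (ENNReal.ofReal p) volume) ∧
    ∀ c : ℝ, 0 < c → (p - 1) * c ^ p - p * c ^ (p - 1) - 1 = 0 →
      lpOperatorNorm (strongMaximal (n := n) (𝕜 := 𝕜)) (ENNReal.ofReal p) volume =
        ENNReal.ofReal (c ^ n) := by
  refine ⟨existsUnique_isMaximalConst hp, fun f hf => memLp_strongMaximal hp hf, ?_⟩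
  intro c hc0 hroot
  have hc : IsMaximalConst p c := ⟨hc0, hroot⟩
  exact le_antisymm (lpOperatorNorm_strongMaximal_le hp hc) (le_lpOperatorNorm_strongMaximal hp hc)
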